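/- Let $\mathbb B$ be the groupoid of finite sets $\underline n=\{1,\dots,n\}$ and bijections, $\mathbb B'$ that of finite pointed sets and basepoint-preserving bijections, and let $\mathsf S:\mathbf{Grpd}\to\mathbf{Grpd}$, $\mathsf S X=\int^{n\in\mathbb B}\mathrm{Map}(\underline n,X)$, be the symmetric monoidal category monad (finite sequences of objects of $X$; unit $\eta^{\mathsf S}$ the inclusion of one-term sequences, multiplication $\mu^{\mathsf S}$ concatenation), represented by the polynomial $1\leftarrow\mathbb B'\to\mathbb B\to 1$. Let $I$ be a set and let $\mathsf R$ be a polynomial monad on $\mathbf{Grpd}/I$, represented by $I\xleftarrow{s}E\xrightarrow{p}B\xrightarrow{t}I$ and cartesian over $\mathsf S$: $E\to B$ is the pullback of $\mathbb B'\to\mathbb B$ along a map $B\to\mathbb B$, and the induced natural transformation $\phi:F_!\mathsf R\Rightarrow\mathsf S F_!$, where $F:I\to 1$ and $F_!:\mathbf{Grpd}/I\to\mathbf{Grpd}$ forgets the map to $I$, is compatible with the units and multiplications of $\mathsf R$ and $\mathsf S$. (When $B\to\mathbb B$ is a discrete fibration, this is the same thing as a symmetric operad in sets with set of colours $I$.)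 Let $A$ be the terminal object of $\mathbf{Grpd}/I$ and $\alpha:\mathsf R A\to A$ the unique map, and put $C_n=F_!\mathsf R^nA$ and $D_n=\mathsf S C_n$, with bottom face maps $d_0=F_!\mathsf R^n\alpha:C_{n+1}\to C_n$ and $d_0=\mathsf SF_!\mathsf R^n\alpha:D_{n+1}\to D_n$, and top face maps $d_{n+1}=\mu^{\mathsf S}\circ\mathsf S\phi:D_{n+1}\to D_n$; let $G=\eta^{\mathsf S}:C_n\to D_n$. For $w\in D_0$ let $(D_1)_w$ be the homotopy fibre over $w$ of $d_0:D_1\to D_0$ and ${}_w(C_1)$ the homotopy fibre over $w$ of $d_1\circ G:C_1\to D_0$. The homotopy sum of a family of groupoids $(E_w)_{w\in W}$ on which the groupoid $W$ acts is the groupoid $\int^{w\in W}E_w$ of pairs $(w,x)$ with $x\in E_w$, a morphism $(w,x)\to(w',x')$ being a morphism $g:w\to w'$ of $W$ together with a morphism $g\cdot x\to x'$ in $E_{w'}$; equivalently, it is $\sum_{w\in\pi_0W}E_w/\mathrm{Aut}(w)$, where $E_w/\mathrm{Aut}(w)$ is the action groupoid. Then the canonical functor $(d_2G,\,d_0):C_2\to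 D_1\times_{D_0}C_1$ to the homotopy pullback of $d_0:D_1\to D_0$ and $d_1G:C_1\to D_0$ is an equivalence, and so is the canonical functor $\int^{w\in D_0}(D_1)_w\times{}_w(C_1)\to D_1\times_{D_0}C_1$ which splits the pullback into its fibres over $D_0$. Hence there is a canonical equivalence of groupoids $$C_2\;\simeq\;\int^{w\in D_0}(D_1)_w\times{}_w(C_1),$$ namely the one compatible, up to natural isomorphism, with these two functors; here the homotopy sum may be taken in either of the two forms above. It is an equivalence over $D_1\times C_1$ (that is, it commutes up to natural isomorphism with $(d_2G,d_0):C_2\to D_1\times C_1$ and the projection from the homotopy sum), and hence also over $D_1\times D_1$, where $C_2$ maps to $D_1\times D_1$ by $C_2\xrightarrow{G}D_2\xrightarrow{(d_2,d_0)}D_1\times D_1$ and the homotopy sum by its projection to $D_1\times C_1$ followed by $\mathrm{id}\times G$. -/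

import Mathlib

open CategoryTheory CategoryTheory.Limits

namespace FaaDiBruno

universe w v₁ v₂ v u

/-! ### The groupoid of finite sets and bijections -/

/-- Objects of the groupoid `𝔹`: the linear orders `{0, …, card - 1}`. -/
structure Bij where
  card : ℕ

/-- Morphisms of `𝔹` are the (not necessarily monotone) bijections. -/
instance : Groupoid.{0} Bij where
  Hom m n := Fin m.card ≃ Fin n.card
  id m := Equiv.refl _
  comp f g := Equiv.trans f g
  inv f := Equiv.symm f
  inv_comp f := Equiv.symm_trans_self f
  comp_inv f := Equiv.self_trans_symm f

/-- The bijection underlying a morphism of `𝔹`. -/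
def Bij.equiv {m n : Bij} (σ : m ⟶ n) : Fin m.card ≃ Fin n.card := σ

@[simp] theorem Bij.equiv_id (m : Bij) (i : Fin m.card) : Bij.equiv (𝟙 m) i = i := rfl

@[simp] theorem Bij.equiv_comp {m n k : Bij} (σ : m ⟶ n) (τ : n ⟶ k) (i : Fin m.card) :
    Bij.equiv (σ ≫ τ) i = Bij.equiv τ (Bij.equiv σ i) := rfl

@[ext] theorem Bij.hom_ext {m n : Bij} {σ τ : m ⟶ n}
    (h : ∀ i, Bij.equiv σ i = Bij.equiv τ i) : σ = τ :=
  Equiv.ext h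

section Fam

variable {B : Type u} [Groupoid.{v₁} B] (a : B ⥤ Bij)

/-- The pullback of the groupoid of finite pointed sets `𝔹' ⟶ 𝔹` along `a : B ⥤ 𝔹`: its objects
are the objects `b` of `B` with a marked element of the finite set `a b`. For `a` the identity
of `𝔹` this is `𝔹'` itself. -/
structure Marked where
  base : B
  point : Fin (a.obj base).card

namespace Marked

variable {a}

/-- Morphisms of `B` that preserve the marked element. -/
@[ext] structure Hom (x y : Marked a) where
  base : x.base ⟶ y.base
  point : Bij.equiv (a.map base) x.point = y.point

instance : Groupoid.{v₁} (Marked a) where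
  Hom x y := Hom x y
  id x := ⟨𝟙 _, by simp⟩
  comp f g := ⟨f.base ≫ g.base, by rw [a.map_comp, Bij.equiv_comp, f.point, g.point]⟩
  id_comp f := Hom.ext (Category.id_comp _)
  comp_id f := Hom.ext (Category.comp_id _)
  assoc f g h := Hom.ext (Category.assoc _ _ _)
  inv f := ⟨Groupoid.inv f.base, by
    rw [← f.point, ← Bij.equiv_comp, ← a.map_comp, Groupoid.comp_inv]; simp⟩
  inv_comp f := Hom.ext (Groupoid.inv_comp _)
  comp_inv f := Hom.ext (Groupoid.comp_inv _)

end Marked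

/-- The groupoid `∫^{b ∈ B} Map(a b, X)`: an object is an object `b` of `B` together with a family
of objects of `X` indexed by the finite set `a b`. -/
structure Fam (X : Type w) where
  base : B
  fam : Fin (a.obj base).card → X

namespace Fam

variable {a} {X : Type w} [Groupoid.{v₂} X]

/-- A morphism `β` of `B` together with a morphism from the `i`-th member of the first family to
the `a(β)(i)`-th member of the second, for each `i`. (Naming `j = a(β)(i)` separately avoids
transports.) -/
structure Hom (x y : Fam a X) where
  base : x.base ⟶ y.base
  fam : ∀ i j, Bij.equiv (a.map base) i = j → (x.fam i ⟶ y.fam j)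

theorem Hom.ext' {x y : Fam a X} {f g : Hom x y} (hb : f.base = g.base)
    (hf : ∀ i j (h : Bij.equiv (a.map f.base) i = j) (h' : Bij.equiv (a.map g.base) i = j),
      f.fam i j h = g.fam i j h') : f = g := by
  obtain ⟨fb, ff⟩ := f
  obtain ⟨gb, gf⟩ := g
  obtain rfl : fb = gb := hb
  congr 1
  funext i j h
  exact hf i j h h

theorem Hom.fam_eq {x y : Fam a X} (f : Hom x y) {i j j'} (h : Bij.equiv (a.map f.base) i = j)
    (h' : Bij.equiv (a.map f.base) i = j') (e : j = j') :
    f.fam i j h ≫ eqToHom (by rw [e]) = f.fam i j' h' := by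
  subst e; simp

/-- The identity morphism of a family. -/
def Hom.id (x : Fam a X) : Hom x x where
  base := 𝟙 _
  fam i j h := eqToHom (by
    have : i = j := by simpa using h
    rw [this])

/-- Composition of morphisms of families. -/
def Hom.comp {x y z : Fam a X} (f : Hom x y) (g : Hom y z) : Hom x z where
  base := f.base ≫ g.base
  fam i k h := f.fam i _ rfl ≫ g.fam _ k (by rw [← h, a.map_comp, Bij.equiv_comp])

theorem Hom.comp_fam {x y z : Fam a X} (f : Hom x y) (g : Hom y z) {i j k}
    (h : Bij.equiv (a.map f.base) i = j) (h' : Bij.equiv (a.map g.base) j = k)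
    (h'' : Bij.equiv (a.map (Hom.comp f g).base) i = k) :
    (Hom.comp f g).fam i k h'' = f.fam i j h ≫ g.fam j k h' := by
  subst h; rfl

theorem Hom.inv_aux {x y : Fam a X} (f : Hom x y) {i j}
    (h : Bij.equiv (a.map (Groupoid.inv f.base)) i = j) : Bij.equiv (a.map f.base) j = i := by
  rw [← h, ← Bij.equiv_comp, ← a.map_comp, Groupoid.inv_comp]; simp

/-- Inverse of a morphism of families. -/
def Hom.inv {x y : Fam a X} (f : Hom x y) : Hom y x where
  base := Groupoid.inv f.base
  fam i j h := Groupoid.inv (f.fam j i (f.inv_aux h))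

theorem Hom.id_comp {x y : Fam a X} (f : Hom x y) : (Hom.id x).comp f = f := by
  refine Hom.ext' (Category.id_comp _) fun i j h h' => ?_
  rw [Hom.comp_fam (Hom.id x) f (j := i) (by simp [Hom.id]) h' h]
  simp [Hom.id]

theorem Hom.comp_id {x y : Fam a X} (f : Hom x y) : f.comp (Hom.id y) = f := by
  refine Hom.ext' (Category.comp_id _) fun i j h h' => ?_
  rw [Hom.comp_fam f (Hom.id y) (j := j) h' (by simp [Hom.id]) h]
  simp [Hom.id]

theorem Hom.assoc {x y z t : Fam a X} (f : Hom x y) (g : Hom y z) (k : Hom z t) :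
    (f.comp g).comp k = f.comp (g.comp k) := by
  refine Hom.ext' (Category.assoc _ _ _) fun i l h h' => ?_
  have e : Bij.equiv (a.map k.base) (Bij.equiv (a.map g.base) (Bij.equiv (a.map f.base) i)) = l := by
    rw [← Bij.equiv_comp, ← a.map_comp, ← Bij.equiv_comp, ← a.map_comp]; exact h'
  have e₁ : Bij.equiv (a.map (f.comp g).base) i =
      Bij.equiv (a.map g.base) (Bij.equiv (a.map f.base) i) := by
    rw [← Bij.equiv_comp, ← a.map_comp]; rfl
  have e₂ : Bij.equiv (a.map (g.comp k).base) (Bij.equiv (a.map f.base) i) = l := by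
    rw [← e, ← Bij.equiv_comp (a.map g.base), ← a.map_comp]; rfl
  rw [Hom.comp_fam (f.comp g) k e₁ e h, Hom.comp_fam f g rfl rfl e₁,
    Hom.comp_fam f (g.comp k) rfl e₂ h', Hom.comp_fam g k rfl e e₂, Category.assoc]

theorem Hom.inv_comp {x y : Fam a X} (f : Hom x y) : f.inv.comp f = Hom.id y := by
  refine Hom.ext' (Groupoid.inv_comp _) fun i j h h' => ?_
  obtain rfl : i = j := by simpa [Hom.id] using h'
  rw [Hom.comp_fam f.inv f rfl (f.inv_aux rfl) h]
  simp [Hom.id, Hom.inv]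

theorem Hom.comp_inv {x y : Fam a X} (f : Hom x y) : f.comp f.inv = Hom.id x := by
  refine Hom.ext' (Groupoid.comp_inv _) fun i j h h' => ?_
  obtain rfl : i = j := by simpa [Hom.id] using h'
  have e : Bij.equiv (a.map f.inv.base) (Bij.equiv (a.map f.base) i) = i := by
    rw [← Bij.equiv_comp, ← a.map_comp]; exact h
  rw [Hom.comp_fam f f.inv rfl e h]
  simp [Hom.id, Hom.inv]

instance : Groupoid.{max v₁ v₂} (Fam a X) where
  Hom := Hom
  id := Hom.id
  comp := Hom.comp
  id_comp := Hom.id_comp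
  comp_id := Hom.comp_id
  assoc := Hom.assoc
  inv := Hom.inv
  inv_comp := Hom.inv_comp
  comp_inv := Hom.comp_inv

/-- Postcomposition of families with a functor. -/
def mapHom {Y : Type w} [Groupoid.{v₂} Y] (F : X ⥤ Y) {x y : Fam a X} (f : Hom x y) :
    Hom (a := a) (X := Y) ⟨x.base, fun i => F.obj (x.fam i)⟩ ⟨y.base, fun i => F.obj (y.fam i)⟩ where
  base := f.base
  fam i j h := F.map (f.fam i j h)

theorem mapHom_id {Y : Type w} [Groupoid.{v₂} Y] (F : X ⥤ Y) (x : Fam a X) :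
    mapHom F (Hom.id x) = Hom.id _ := by
  refine Hom.ext' rfl fun i j h h' => ?_
  simp [Hom.id, mapHom, eqToHom_map]

theorem mapHom_comp {Y : Type w} [Groupoid.{v₂} Y] (F : X ⥤ Y) {x y z : Fam a X} (f : Hom x y)
    (g : Hom y z) : mapHom F (f.comp g) = (mapHom F f).comp (mapHom F g) := by
  refine Hom.ext' rfl fun i j h h' => ?_
  simp [Hom.comp, mapHom]

end Fam

end Fam

/-! ### The symmetric monoidal category monad -/

section SymMon

/-- The symmetric monoidal category monad as an endofunctor of the category of groupoids:
`S X = ∫^{n ∈ 𝔹} Map(n, X)`, the groupoid of finite sequences of objects of `X`. It is the polynomial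
functor of `1 ← 𝔹' → 𝔹 → 1`. -/
def S : Grpd.{u, u} ⥤ Grpd.{u, u} where
  obj X := Grpd.of (Fam (𝟭 Bij) X)
  map {X Y} F :=
    { obj := fun x => ⟨x.base, fun i => (F : X ⥤ Y).obj (x.fam i)⟩
      map := fun f => Fam.mapHom (F : X ⥤ Y) f
      map_id := fun x => Fam.mapHom_id (F : X ⥤ Y) x
      map_comp := fun f g => Fam.mapHom_comp (F : X ⥤ Y) f g }
  map_id _ := rfl
  map_comp _ _ := rfl

/-- A morphism of `X` as a morphism of singleton sequences. -/
def unitMap {X : Type u} [Groupoid.{u} X] {x y : X} (f : x ⟶ y) :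
    Fam.Hom (a := 𝟭 Bij) (X := X) ⟨⟨1⟩, fun _ => x⟩ ⟨⟨1⟩, fun _ => y⟩ where
  base := 𝟙 _
  fam _ _ _ := f

theorem unitMap_id {X : Type u} [Groupoid.{u} X] (x : X) : unitMap (𝟙 x) = Fam.Hom.id _ :=
  Fam.Hom.ext' rfl fun _ _ _ _ => rfl

theorem unitMap_comp {X : Type u} [Groupoid.{u} X] {x y z : X} (f : x ⟶ y) (g : y ⟶ z) :
    unitMap (f ≫ g) = (unitMap f).comp (unitMap g) :=
  Fam.Hom.ext' rfl fun _ _ _ _ => rfl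

/-- The inclusion of `X` into `S X` as the singleton sequences. -/
def unitFunctor (X : Type u) [Groupoid.{u} X] : X ⥤ Fam (𝟭 Bij) X where
  obj x := ⟨⟨1⟩, fun _ => x⟩
  map f := unitMap f
  map_id := unitMap_id
  map_comp := unitMap_comp

variable {X : Type u} [Groupoid.{u} X]

/-- Concatenation of a sequence of sequences (in lexicographic order). -/
def flattenObj (x : Fam (𝟭 Bij) (Fam (𝟭 Bij) X)) : Fam (𝟭 Bij) X where
  base := ⟨∑ i, (x.fam i).base.card⟩
  fam k := (x.fam (finSigmaFinEquiv.symm k).1).fam (finSigmaFinEquiv.symm k).2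

/-- The bijection of index sets induced by a morphism of sequences of sequences. -/
def sigmaEquiv {x y : Fam (𝟭 Bij) (Fam (𝟭 Bij) X)} (f : Fam.Hom x y) :
    (Σ i, Fin (x.fam i).base.card) ≃ (Σ j, Fin (y.fam j).base.card) :=
  Equiv.sigmaCongr (Bij.equiv f.base) fun i => Bij.equiv (f.fam i _ rfl).base

theorem sigmaEquiv_fst {x y : Fam (𝟭 Bij) (Fam (𝟭 Bij) X)} (f : Fam.Hom x y) {p q}
    (h : sigmaEquiv f p = q) : Bij.equiv f.base p.1 = q.1 := by
  subst h; rfl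

theorem sigmaEquiv_snd {x y : Fam (𝟭 Bij) (Fam (𝟭 Bij) X)} (f : Fam.Hom x y) {p q}
    (h : sigmaEquiv f p = q) :
    Bij.equiv (f.fam p.1 q.1 (sigmaEquiv_fst f h)).base p.2 = q.2 := by
  subst h; rfl

theorem sigmaEquiv_eq {x y : Fam (𝟭 Bij) (Fam (𝟭 Bij) X)} (f : Fam.Hom x y) {p q}
    (h₁ : Bij.equiv f.base p.1 = q.1) (h₂ : Bij.equiv (f.fam p.1 q.1 h₁).base p.2 = q.2) :
    sigmaEquiv f p = q := by
  obtain ⟨i, k⟩ := p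
  obtain ⟨j, l⟩ := q
  change Bij.equiv f.base i = j at h₁
  subst h₁
  change Bij.equiv (f.fam i _ rfl).base k = l at h₂
  subst h₂
  rfl

/-- The bijection of concatenated index sets induced by a morphism. -/
def flattenBase {x y : Fam (𝟭 Bij) (Fam (𝟭 Bij) X)} (f : Fam.Hom x y) :
    (flattenObj x).base ⟶ (flattenObj y).base :=
  ((finSigmaFinEquiv.symm.trans (sigmaEquiv f)).trans finSigmaFinEquiv :
    Fin (∑ i, (x.fam i).base.card) ≃ Fin (∑ i, (y.fam i).base.card))

theorem flattenBase_index {x y : Fam (𝟭 Bij) (Fam (𝟭 Bij) X)} (f : Fam.Hom x y)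
    {k : Fin (∑ i, (x.fam i).base.card)} {l : Fin (∑ i, (y.fam i).base.card)}
    (h : Bij.equiv (flattenBase f) k = l) :
    sigmaEquiv f (finSigmaFinEquiv.symm k) = finSigmaFinEquiv.symm l := by
  rw [← h]
  exact (Equiv.symm_apply_apply _ _).symm

/-- Concatenation on morphisms: the permutations are composed blockwise. -/
def flattenMap {x y : Fam (𝟭 Bij) (Fam (𝟭 Bij) X)} (f : Fam.Hom x y) :
    Fam.Hom (flattenObj x) (flattenObj y) where
  base := flattenBase f
  fam _ _ h := (f.fam _ _ (sigmaEquiv_fst f (flattenBase_index f h))).fam _ _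
    (sigmaEquiv_snd f (flattenBase_index f h))

theorem flattenMap_base {x y : Fam (𝟭 Bij) (Fam (𝟭 Bij) X)} (f : Fam.Hom x y)
    (k : Fin (∑ i, (x.fam i).base.card)) :
    Bij.equiv (flattenMap f).base k = finSigmaFinEquiv (sigmaEquiv f (finSigmaFinEquiv.symm k)) :=
  rfl

theorem flattenMap_id (x : Fam (𝟭 Bij) (Fam (𝟭 Bij) X)) :
    flattenMap (Fam.Hom.id x) = Fam.Hom.id _ := by
  have key : ∀ p, sigmaEquiv (Fam.Hom.id x) p = p := fun p => rfl
  refine Fam.Hom.ext' ?_ fun k l h h' => ?_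
  · refine Bij.hom_ext fun k => ?_
    refine (flattenMap_base _ k).trans ?_
    rw [key]
    exact Equiv.apply_symm_apply _ _
  · obtain rfl : k = l := h'
    rfl

theorem flattenMap_comp {x y z : Fam (𝟭 Bij) (Fam (𝟭 Bij) X)} (f : Fam.Hom x y)
    (g : Fam.Hom y z) :
    flattenMap (f.comp g) = (flattenMap f).comp (flattenMap g) := by
  have key : ∀ p, sigmaEquiv (f.comp g) p = sigmaEquiv g (sigmaEquiv f p) := fun p => rfl
  refine Fam.Hom.ext' ?_ fun k l h h' => ?_
  · refine Bij.hom_ext fun k => ?_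
    refine (flattenMap_base _ k).trans ?_
    refine Eq.trans ?_ (flattenMap_base g (Bij.equiv (flattenMap f).base k)).symm
    refine congrArg finSigmaFinEquiv ?_
    rw [key]
    exact congrArg (sigmaEquiv g) (Equiv.symm_apply_apply _ _).symm
  · have aux : ∀ (p : Σ i, Fin (x.fam i).base.card) (q : Σ i, Fin (y.fam i).base.card)
        (r : Σ i, Fin (z.fam i).base.card) (h₁ : sigmaEquiv f p = q) (h₂ : sigmaEquiv g q = r)
        (h₃ : sigmaEquiv (f.comp g) p = r),
        ((f.comp g).fam _ _ (sigmaEquiv_fst _ h₃)).fam _ _ (sigmaEquiv_snd _ h₃) =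
          (f.fam _ _ (sigmaEquiv_fst f h₁)).fam _ _ (sigmaEquiv_snd f h₁) ≫
            (g.fam _ _ (sigmaEquiv_fst g h₂)).fam _ _ (sigmaEquiv_snd g h₂) := by
      intro p q r h₁ h₂ h₃
      subst h₁
      rfl
    exact aux _ _ _ (flattenBase_index f rfl) (flattenBase_index g h') (flattenBase_index _ h)

/-- The multiplication of `S` as a functor. -/
def flattenFunctor (X : Type u) [Groupoid.{u} X] :
    Fam (𝟭 Bij) (Fam (𝟭 Bij) X) ⥤ Fam (𝟭 Bij) X where
  obj := flattenObj
  map f := flattenMap f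
  map_id := flattenMap_id
  map_comp := flattenMap_comp

/-- The unit of the symmetric monoidal category monad. -/
def unitS : 𝟭 Grpd.{u, u} ⟶ S where
  app X := unitFunctor X
  naturality X Y F := by
    refine CategoryTheory.Functor.hext (fun _ => rfl) fun x y f => heq_of_eq ?_
    rfl

/-- The multiplication of the symmetric monoidal category monad. -/
def multS : S ⋙ S ⟶ S.{u} where
  app X := flattenFunctor X
  naturality _ _ _ := rfl

end SymMon

/-! ### Homotopy fibres and homotopy sums -/

section HomotopySum

variable {W X Y : Type u} [Groupoid.{u} W] [Groupoid.{u} X] [Groupoid.{u} Y]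

/-- The homotopy sum `∫^{w ∈ W} E_w` of a family of groupoids indexed by a groupoid `W`, in its
choice-free form: an object is a pair `(w, x)` with `x` in `E_w`, and a morphism
`(w, x) ⟶ (w', x')` is a morphism `g : w ⟶ w'` with a morphism `g x ⟶ x'` in `E_{w'}`. -/
abbrev HomotopySum (E : W ⥤ Cat.{u, u}) : Type u := Grothendieck E

/-- The homotopy sum in the form `∑_{w ∈ π₀ W} E_w / Aut(w)`: the disjoint union, over one
representative `w` of each isomorphism class of `W`, of the action groupoids `E_w / Aut(w)`. The
skeleton of the groupoid `W` is the disjoint union of the groups `Aut(w)`. -/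
abbrev SumOfQuotients (E : W ⥤ Cat.{u, u}) : Type u := Grothendieck (fromSkeleton W ⋙ E)

/-- The canonical functor `∑_{w ∈ π₀ W} E_w / Aut(w) ⟶ ∫^{w ∈ W} E_w`. -/
noncomputable abbrev SumOfQuotients.inclusion (E : W ⥤ Cat.{u, u}) :
    SumOfQuotients E ⥤ HomotopySum E :=
  Grothendieck.pre E (fromSkeleton W)

/-- The homotopy fibre of `F : X ⥤ W` over `w`: objects are pairs of an object `x` of `X` and a
morphism `F x ⟶ w` (an isomorphism, as `W` is a groupoid). -/
abbrev HomotopyFibre (F : X ⥤ W) (w : W) : Type u := CostructuredArrow F w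

variable (F : X ⥤ W) (H : Y ⥤ W)

/-- The action of a morphism of `W` on the products `X_w × Y_w` of homotopy fibres, by
composition. -/
def fibreProductMap {w w' : W} (g : w ⟶ w') :
    HomotopyFibre F w × HomotopyFibre H w ⥤ HomotopyFibre F w' × HomotopyFibre H w' :=
  Functor.prod (CostructuredArrow.map g) (CostructuredArrow.map g)

/-- The family `w ↦ X_w × Y_w` of products of homotopy fibres. -/
def fibreProduct : W ⥤ Cat.{u, u} where
  obj w := Cat.of (HomotopyFibre F w × HomotopyFibre H w)
  map g := (fibreProductMap F H g).toCatHom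
  map_id w := by
    have h₁ := congrArg Cat.Hom.toFunctor ((CostructuredArrow.functor F).map_id w)
    have h₂ := congrArg Cat.Hom.toFunctor ((CostructuredArrow.functor H).map_id w)
    change CostructuredArrow.map (𝟙 w) = 𝟭 _ at h₁ h₂
    rw [fibreProductMap, h₁, h₂]
    rfl
  map_comp g g' := by
    have h₁ := congrArg Cat.Hom.toFunctor ((CostructuredArrow.functor F).map_comp g g')
    have h₂ := congrArg Cat.Hom.toFunctor ((CostructuredArrow.functor H).map_comp g g')
    change CostructuredArrow.map (g ≫ g') = CostructuredArrow.map g ⋙ CostructuredArrow.map g'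
      at h₁ h₂
    rw [fibreProductMap, h₁, h₂]
    rfl

variable {F H}

theorem eqToHom_left {w : W} {p q : HomotopyFibre F w × HomotopyFibre H w} (h : p = q) :
    (eqToHom h).1.left = eqToHom (congrArg (fun r => r.1.left) h) ∧
      (eqToHom h).2.left = eqToHom (congrArg (fun r => r.2.left) h) := by
  subst h
  exact ⟨rfl, rfl⟩

theorem id_left (p : HomotopySum (fibreProduct F H)) :
    (Grothendieck.Hom.fiber (𝟙 p)).1.left = 𝟙 p.fiber.1.left ∧
      (Grothendieck.Hom.fiber (𝟙 p)).2.left = 𝟙 p.fiber.2.left :=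
  eqToHom_left (congrArg (fun T : _ ⟶ _ => (Cat.Hom.toFunctor T).obj p.fiber)
    ((fibreProduct F H).map_id p.base))

theorem comp_left {p q r : HomotopySum (fibreProduct F H)} (f : p ⟶ q) (g : q ⟶ r) :
    (Grothendieck.Hom.fiber (f ≫ g)).1.left = f.fiber.1.left ≫ g.fiber.1.left ∧
      (Grothendieck.Hom.fiber (f ≫ g)).2.left = f.fiber.2.left ≫ g.fiber.2.left := by
  have e : ((fibreProduct F H).map g.base).toFunctor.obj
      (((fibreProduct F H).map f.base).toFunctor.obj p.fiber) =
      ((fibreProduct F H).map (f ≫ g).base).toFunctor.obj p.fiber := by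
    rw [Grothendieck.comp_base, Functor.map_comp]; rfl
  have h := eqToHom_left e.symm
  constructor
  · refine (congrArg (· ≫ f.fiber.1.left ≫ g.fiber.1.left) h.1).trans ?_
    exact Category.id_comp _
  · refine (congrArg (· ≫ f.fiber.2.left ≫ g.fiber.2.left) h.2).trans ?_
    exact Category.id_comp _

theorem fiber_w {p q : HomotopySum (fibreProduct F H)} (f : p ⟶ q) :
    F.map f.fiber.1.left ≫ q.fiber.1.hom = p.fiber.1.hom ≫ f.base ∧
      H.map f.fiber.2.left ≫ q.fiber.2.hom = p.fiber.2.hom ≫ f.base :=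
  ⟨CostructuredArrow.w f.fiber.1, CostructuredArrow.w f.fiber.2⟩

theorem split_w {x x' : X} {y y' : Y} {w w' : W} {p : F.obj x ⟶ w} {q : H.obj y ⟶ w}
    {p' : F.obj x' ⟶ w'} {q' : H.obj y' ⟶ w'} {g : w ⟶ w'} {m : x ⟶ x'} {n : y ⟶ y'}
    (hp : F.map m ≫ p' = p ≫ g) (hq : H.map n ≫ q' = q ≫ g) :
    F.map m ≫ p' ≫ inv q' = (p ≫ inv q) ≫ H.map n := by
  rw [← Category.assoc, hp, IsIso.comp_inv_eq]
  simp only [Category.assoc]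
  rw [hq, IsIso.inv_hom_id_assoc]

variable (F H)

/-- The projection `∫^{w ∈ W} X_w × Y_w ⟶ X × Y`. -/
def fibreProductProj : HomotopySum (fibreProduct F H) ⥤ X × Y where
  obj p := (p.fiber.1.left, p.fiber.2.left)
  map f := Prod.mkHom f.fiber.1.left f.fiber.2.left
  map_id p := Prod.ext (id_left p).1 (id_left p).2
  map_comp f g := Prod.ext (comp_left f g).1 (comp_left f g).2

/-- The splitting of the homotopy pullback `X ×_W Y` into its fibres over `W`, as a functor
`∫^{w ∈ W} X_w × Y_w ⟶ X ×_W Y`: it sends `(w, F x ⟶ w, H y ⟶ w)` to `x` and `y` with the composite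
`F x ⟶ w ⟶ H y`. -/
noncomputable def fibreProductSplit :
    HomotopySum (fibreProduct F H) ⥤ CategoricalPullback F H where
  obj p := ⟨p.fiber.1.left, p.fiber.2.left, asIso p.fiber.1.hom ≪≫ (asIso p.fiber.2.hom).symm⟩
  map f := ⟨f.fiber.1.left, f.fiber.2.left, split_w (fiber_w f).1 (fiber_w f).2⟩
  map_id p := CategoricalPullback.hom_ext (id_left p).1 (id_left p).2
  map_comp f g := CategoricalPullback.hom_ext (comp_left f g).1 (comp_left f g).2

end HomotopySum

/-! ### Polynomial monads over the symmetric monoidal category monad -/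

/-- The slice `Grpd / I` over a set `I` (regarded as a discrete groupoid). -/
abbrev Slice (I : Type u) : Type (u + 1) := Over (Grpd.of (Discrete I) : Grpd.{u, u})

/-- The functor `F_! : Grpd / I ⟶ Grpd / 1 = Grpd` given by composition with `F : I ⟶ 1`. -/
abbrev lowershriek (I : Type u) : Slice I ⥤ Grpd.{u, u} := Over.forget _

/-- A polynomial `I ← E → B → I` of groupoids, with `I` a set, together with a cartesian morphism
to the polynomial `1 ← 𝔹' → 𝔹 → 1`, that is, a functor `arity : B ⥤ 𝔹` along which `E → B` is the
pullback of `𝔹' → 𝔹`. -/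
structure Poly (I : Type u) where
  B : Type u
  [groupoid : Groupoid.{u} B]
  arity : B ⥤ Bij
  source : Marked arity ⥤ Discrete I
  target : B ⥤ Discrete I

attribute [instance] Poly.groupoid

namespace Poly

variable {I : Type u} (P : Poly I)

/-- The groupoid underlying `t_! p_* s^* X`, for the polynomial functor of `I ← E → B → I` (with
maps `s`, `p`, `t`) and `X` over `I`: an object is an object `b` of `B` with a family of objects of
`X`, indexed by the fibre of `E → B` over `b`, that lies over `I` via `s`. -/
structure Ev (X : Slice I) where
  toFam : Fam P.arity X.left
  colour : ∀ i, (X.hom : X.left ⥤ Discrete I).obj (toFam.fam i) = P.source.obj ⟨toFam.base, i⟩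

/-- Morphisms are those of families; they lie over `I` because `I` is discrete. -/
instance (X : Slice I) : Groupoid.{u} (P.Ev X) where
  Hom x y := Fam.Hom x.toFam y.toFam
  id x := Fam.Hom.id x.toFam
  comp := Fam.Hom.comp
  id_comp := Fam.Hom.id_comp
  comp_id := Fam.Hom.comp_id
  assoc := Fam.Hom.assoc
  inv := Fam.Hom.inv
  inv_comp := Fam.Hom.inv_comp
  comp_inv := Fam.Hom.comp_inv

/-- The structure map of `t_! p_* s^* X` to `I`. -/
def evHom (X : Slice I) : P.Ev X ⥤ Discrete I where
  obj x := P.target.obj x.toFam.base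
  map f := P.target.map (Fam.Hom.base f)
  map_id _ := P.target.map_id _
  map_comp _ _ := P.target.map_comp _ _

/-- The action of `t_! p_* s^*` on morphisms. -/
def evMap {X Y : Slice I} (F : X ⟶ Y) : P.Ev X ⥤ P.Ev Y where
  obj x :=
    { toFam := ⟨x.toFam.base, fun i => (F.left : X.left ⥤ Y.left).obj (x.toFam.fam i)⟩
      colour := fun i => by
        rw [← x.colour i, ← Over.w F]
        rfl }
  map f := Fam.mapHom (F.left : X.left ⥤ Y.left) f
  map_id _ := Fam.mapHom_id _ _
  map_comp _ _ := Fam.mapHom_comp _ _ _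

/-- `t_! p_* s^* X` as an object over `I`. -/
def evObj (X : Slice I) : Slice I :=
  Over.mk (show Grpd.of (P.Ev X) ⟶ Grpd.of (Discrete I) from P.evHom X)

/-- `t_! p_* s^* F` as a morphism over `I`. -/
def evHomMk {X Y : Slice I} (F : X ⟶ Y) : P.evObj X ⟶ P.evObj Y :=
  Over.homMk (show Grpd.of (P.Ev X) ⟶ Grpd.of (P.Ev Y) from P.evMap F) rfl

/-- The polynomial functor `t_! p_* s^* : Grpd / I ⟶ Grpd / I`. -/
def functor : Slice I ⥤ Slice I where
  obj := P.evObj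
  map := P.evHomMk
  map_id X := by
    apply Over.OverMorphism.ext
    rfl
  map_comp F G := by
    apply Over.OverMorphism.ext
    rfl

/-- The component at `X` of the natural transformation `F_! R ⟶ S F_!`. -/
def phiApp (X : Slice I) : P.Ev X ⥤ Fam (𝟭 Bij) X.left where
  obj x := ⟨P.arity.obj x.toFam.base, x.toFam.fam⟩
  map f := (⟨P.arity.map (Fam.Hom.base f), Fam.Hom.fam f⟩ : Fam.Hom _ _)
  map_id x := Fam.Hom.ext' (P.arity.map_id _) fun _ _ _ _ => rfl
  map_comp {x y z} f g := by
    refine Fam.Hom.ext' (P.arity.map_comp (Fam.Hom.base f) (Fam.Hom.base g)) fun _ _ _ _ => ?_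
    rfl

/-- The natural transformation `φ : F_! R ⟶ S F_!` induced by the morphism of polynomials. -/
def phi : P.functor ⋙ lowershriek I ⟶ lowershriek I ⋙ S where
  app X := P.phiApp X
  naturality _ _ _ := rfl

end Poly

/-- A polynomial monad `R` on `Grpd / I`, with `I` a set, cartesian over the symmetric monoidal
category monad `S`: a monad structure on the polynomial functor of a polynomial
`I ← E → B → I` cartesian over `1 ← 𝔹' → 𝔹 → 1`, such that `(F_!, φ)` is a monad opfunctor from
`R` to `S`. -/
structure PolynomialMonad (I : Type u) where
  P : Poly I
  η : 𝟭 (Slice I) ⟶ P.functor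
  μ : P.functor ⋙ P.functor ⟶ P.functor
  left_unit : ∀ X, η.app (P.functor.obj X) ≫ μ.app X = 𝟙 _
  right_unit : ∀ X, P.functor.map (η.app X) ≫ μ.app X = 𝟙 _
  assoc : ∀ X, P.functor.map (μ.app X) ≫ μ.app X = μ.app (P.functor.obj X) ≫ μ.app X
  unit_phi : ∀ X, (lowershriek I).map (η.app X) ≫ P.phi.app X = unitS.app ((lowershriek I).obj X)
  mult_phi : ∀ X, (lowershriek I).map (μ.app X) ≫ P.phi.app X =
    P.phi.app (P.functor.obj X) ≫ S.map (P.phi.app X) ≫ multS.app ((lowershriek I).obj X)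

namespace PolynomialMonad

variable {I : Type u} (R : PolynomialMonad I)

/-- The terminal object `A` of `Grpd / I`. -/
abbrev A (I : Type u) : Slice I := Over.mk (𝟙 (Grpd.of (Discrete I)))

/-- `R^n A`. -/
def iter : ℕ → Slice I
  | 0 => A I
  | n + 1 => R.P.functor.obj (iter n)

/-- The bottom face map `d₀ : R^{n+1} A ⟶ R^n A`, which is `R^n` applied to the unique map
`α : R A ⟶ A` over `I`. -/
noncomputable def iterFace : ∀ n, R.iter (n + 1) ⟶ R.iter n
  | 0 => Over.mkIdTerminal.from _
  | n + 1 => R.P.functor.map (iterFace n)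

/-- `C_n = F_! R^n A`. -/
def C (n : ℕ) : Grpd.{u, u} := (lowershriek I).obj (R.iter n)

/-- The bottom face map `d₀ : C_{n+1} ⟶ C_n`. -/
noncomputable def d₀C (n : ℕ) : R.C (n + 1) ⟶ R.C n := (lowershriek I).map (R.iterFace n)

/-- `D_n = S F_! R^n A`. -/
def D (n : ℕ) : Grpd.{u, u} := S.obj (R.C n)

/-- The bottom face map `d₀ : D_{n+1} ⟶ D_n`. -/
noncomputable def d₀ (n : ℕ) : R.D (n + 1) ⟶ R.D n := S.map (R.d₀C n)

/-- `φ` at `R^n A`. -/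
def phiC (n : ℕ) : R.C (n + 1) ⟶ S.obj (R.C n) := R.P.phi.app (R.iter n)

/-- The top face map `d_{n+1} : D_{n+1} ⟶ D_n`, that is, `μ^S ∘ S φ`. -/
def dTop (n : ℕ) : R.D (n + 1) ⟶ R.D n := S.map (R.phiC n) ≫ multS.app (R.C n)

/-- The inclusion `η^S : C_n ⟶ D_n` of singleton families; for `n = 1` this is the connected Green
function. -/
def G (n : ℕ) : R.C n ⟶ R.D n := unitS.app (R.C n)

theorem G_d₀ (n : ℕ) : R.G (n + 1) ≫ R.d₀ n = R.d₀C n ≫ R.G n :=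
  (unitS.naturality (R.d₀C n)).symm

theorem phiC_d₀ (n : ℕ) : R.phiC (n + 1) ≫ S.map (R.d₀C n) = R.d₀C (n + 1) ≫ R.phiC n :=
  (R.P.phi.naturality (R.iterFace n)).symm

theorem dTop_d₀ (n : ℕ) : R.dTop (n + 1) ≫ R.d₀ n = R.d₀ (n + 1) ≫ R.dTop n := by
  have h₁ : S.map (R.phiC (n + 1)) ≫ multS.app (R.C (n + 1)) ≫ S.map (R.d₀C n) =
      S.map (R.phiC (n + 1)) ≫ S.map (S.map (R.d₀C n)) ≫ multS.app (R.C n) :=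
    congrArg (S.map (R.phiC (n + 1)) ≫ ·) (multS.naturality (R.d₀C n)).symm
  have h₂ : S.map (R.phiC (n + 1)) ≫ S.map (S.map (R.d₀C n)) =
      S.map (R.d₀C (n + 1)) ≫ S.map (R.phiC n) :=
    (S.map_comp _ _).symm.trans ((congrArg S.map (R.phiC_d₀ n)).trans (S.map_comp _ _))
  exact h₁.trans (congrArg (· ≫ multS.app (R.C n)) h₂)

theorem square : (R.G 2 ≫ R.dTop 1) ≫ R.d₀ 0 = R.d₀C 1 ≫ R.G 1 ≫ R.dTop 0 := by
  rw [Category.assoc, dTop_d₀, ← Category.assoc, G_d₀, Category.assoc]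

/-- The map `d₂ ∘ η : C₂ ⟶ D₂ ⟶ D₁`. -/
def outer : R.C 2 ⥤ R.D 1 := (R.G 2 ≫ R.dTop 1 : R.C 2 ⟶ R.D 1)

/-- The map `d₀ : C₂ ⟶ C₁`. -/
noncomputable def inner : R.C 2 ⥤ R.C 1 := R.d₀C 1

/-- The map `d₀ : D₁ ⟶ D₀`, whose fibre over `w` is `(D₁)_w`. -/
noncomputable def out : R.D 1 ⥤ R.D 0 := R.d₀ 0

/-- The composite `C₁ ⟶ D₁ ⟶ D₀` of the connected Green function with `d₁`, whose fibre over `w`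
is `_w(C₁)`. -/
def inp : R.C 1 ⥤ R.D 0 := (R.G 1 ≫ R.dTop 0 : R.C 1 ⟶ R.D 0)

/-- The connected Green function `C₁ ⟶ D₁`. -/
def green : R.C 1 ⥤ R.D 1 := R.G 1

/-- The inclusion `C₂ ⟶ D₂` of singleton families. -/
def single : R.C 2 ⥤ R.D 2 := R.G 2

/-- The map `(d₂, d₀) : D₂ ⟶ D₁ × D₁`. -/
noncomputable def edges : R.D 2 ⥤ R.D 1 × R.D 1 :=
  Functor.prod' (R.dTop 1 : R.D 2 ⥤ R.D 1) (R.d₀ 1 : R.D 2 ⥤ R.D 1)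

theorem outer_out : R.outer ⋙ R.out = R.inner ⋙ R.inp := R.square

/-- The canonical functor `C₂ ⟶ D₁ ×_{D₀} C₁` to the homotopy pullback, with components `d₂ ∘ η` and
`d₀`, given by the strictly commutative square. -/
noncomputable def comparison : R.C 2 ⥤ CategoricalPullback R.out R.inp :=
  (CategoricalPullback.CatCommSqOver.toFunctorToCategoricalPullback R.out R.inp (R.C 2)).obj
    ⟨R.outer, R.inner, eqToIso R.outer_out⟩

end PolynomialMonad

end FaaDiBruno

namespace FaaDiBruno

universe u

/-! ### Homotopy pullbacks and isomorphic squares. -/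

section Pullback

variable {Q X Y Z : Type*} [Category* Q] [Category* X] [Category* Y] [Category* Z]
  {L L' : Q ⥤ X} {T : Q ⥤ Y} {F : X ⥤ Z} {H H' : Y ⥤ Z}

/-! The point is that `φ` is cartesian: its naturality square at any `f : X ⟶ Y` over `I` is a
homotopy pullback. Given a sequence of objects of `X`, an operation decorated by objects of `Y`, and
an isomorphism between the two sequences underlying them in `Y`, the bijection in that isomorphism
distributes the sequence over the inputs of the operation. The colours match because `I` is
discrete. This is carried by `hom_ext_of_phi`, `exists_hom_of_phi` and `exists_obj_of_phi`.

The square defining `comparison` is not literally a naturality square of `φ`: its legs are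
composites `μ^S ∘ Sφ ∘ η^S`. By naturality of `η^S` these equal `μ^S ∘ η^S ∘ φ`, which the unit law
of `S` identifies with `φ`, but only up to the reindexing `flattenUnitIso`. This isomorphism is
natural in the sequence and compatible with `S F`, so the two squares are isomorphic and
`comparison` is an equivalence.

Splitting a homotopy pullback into its fibres is formal: in a groupoid, an isomorphism `F x ≅ H y`
is the same, up to contractible choice, as an object `w` with isomorphisms `F x ⟶ w` and `H y ⟶ w`.
Inverting the splitting after `comparison` gives the equivalence. -/

theorem comp_iso_square_iff (β : H ≅ H') {y y' : Y} (g : y ⟶ y') {z z' : Z} (f : z ⟶ z')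
    (i : z ⟶ H.obj y) (i' : z' ⟶ H.obj y') :
    f ≫ i' ≫ β.hom.app y' = (i ≫ β.hom.app y) ≫ H'.map g ↔ f ≫ i' = i ≫ H.map g := by
  rw [Category.assoc, ← β.hom.naturality, ← cancel_mono (β.hom.app y')]
  simp only [Category.assoc]

/-- The functor between categorical pullbacks induced by an isomorphism of one leg. -/
def pullbackCongr (F : X ⥤ Z) (β : H ≅ H') : CategoricalPullback F H ⥤ CategoricalPullback F H' where
  obj x := ⟨x.fst, x.snd, x.iso ≪≫ β.app x.snd⟩
  map f := ⟨f.fst, f.snd, (comp_iso_square_iff β _ _ _ _).2 f.w⟩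
  map_id _ := rfl
  map_comp _ _ := rfl

instance (β : H ≅ H') : (pullbackCongr F β).IsEquivalence where
  faithful := ⟨fun {x y f g} h => by
    have h₁ := congrArg (fun k => CategoricalPullback.Hom.fst k) h
    have h₂ := congrArg (fun k => CategoricalPullback.Hom.snd k) h
    exact CategoricalPullback.hom_ext h₁ h₂⟩
  full := ⟨fun {x y} f => ⟨⟨f.fst, f.snd, (comp_iso_square_iff β _ _ _ _).1 f.w⟩, rfl⟩⟩
  essSurj := ⟨fun y => ⟨⟨y.fst, y.snd, y.iso ≪≫ (β.app y.snd).symm⟩,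
    ⟨CategoricalPullback.mkIso (Iso.refl _) (Iso.refl _) (by
      change F.map (𝟙 y.fst) ≫ y.iso.hom =
        ((y.iso.hom ≫ β.inv.app y.snd) ≫ β.hom.app y.snd) ≫ H'.map (𝟙 y.snd)
      simp)⟩⟩⟩

/-- A square isomorphic to a homotopy pullback square is a homotopy pullback square. -/
theorem isEquivalence_toCategoricalPullback_of_iso (e : L ⋙ F ≅ T ⋙ H) (e' : L' ⋙ F ≅ T ⋙ H')
    (α : L ≅ L') (β : H ≅ H')
    (w : ∀ c, F.map (α.hom.app c) ≫ e'.hom.app c = e.hom.app c ≫ β.hom.app (T.obj c))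
    (h : ((CategoricalPullback.CatCommSqOver.toFunctorToCategoricalPullback F H' Q).obj
      ⟨L', T, e'⟩).IsEquivalence) :
    ((CategoricalPullback.CatCommSqOver.toFunctorToCategoricalPullback F H Q).obj
      ⟨L, T, e⟩).IsEquivalence := by
  let K := (CategoricalPullback.CatCommSqOver.toFunctorToCategoricalPullback F H Q).obj ⟨L, T, e⟩
  let K' := (CategoricalPullback.CatCommSqOver.toFunctorToCategoricalPullback F H' Q).obj
    ⟨L', T, e'⟩
  -- The condition `w` says exactly that `α` and the identity of `T` are morphisms in the pullback;
  -- two-out-of-three then applies.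
  let i : K ⋙ pullbackCongr F β ≅ K' := NatIso.ofComponents
    (fun c => CategoricalPullback.mkIso (α.app c) (Iso.refl (T.obj c)) (by
      change F.map (α.hom.app c) ≫ e'.hom.app c =
        (e.hom.app c ≫ β.hom.app (T.obj c)) ≫ H'.map (𝟙 (T.obj c))
      rw [w, H'.map_id, Category.comp_id]))
    (fun {c d} f => CategoricalPullback.hom_ext (α.hom.naturality f)
      ((Category.comp_id (T.map f)).trans (Category.id_comp (T.map f)).symm))
  have : (K ⋙ pullbackCongr F β).IsEquivalence := Functor.isEquivalence_of_iso i.symm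
  exact Functor.isEquivalence_of_comp_right K (pullbackCongr F β)

end Pullback

/-! ### Splitting a homotopy pullback into its fibres. -/

section HomotopySum

variable {W X Y : Type u} [Groupoid.{u} W] [Groupoid.{u} X] [Groupoid.{u} Y]

/-- The base morphism is forced, since the structure map `p.fiber.1.hom` is invertible in `W`. This
gives faithfulness of the splitting. -/
theorem fibre_hom_ext {F : X ⥤ W} {H : Y ⥤ W} {p q : HomotopySum (fibreProduct F H)} {f g : p ⟶ q}
    (h₁ : f.fiber.1.left = g.fiber.1.left) (h₂ : f.fiber.2.left = g.fiber.2.left) : f = g := by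
  have hb : f.base = g.base :=
    (cancel_epi p.fiber.1.hom).1 (((fiber_w f).1.symm.trans
      (congrArg (fun k => F.map k ≫ q.fiber.1.hom) h₁)).trans (fiber_w g).1)
  obtain ⟨fb, ff⟩ := f
  obtain ⟨gb, gf⟩ := g
  obtain rfl : fb = gb := hb
  congr 1
  exact Prod.ext (CostructuredArrow.hom_ext _ _ h₁) (CostructuredArrow.hom_ext _ _ h₂)

/-- Fullness of the splitting: the first equation forces `g = p⁻¹ m p'`, and the hypothesis is what
makes the second hold too. -/
theorem exists_of_split_w {a a' b b' w w' : W} {p : a ⟶ w} {q : b ⟶ w} {p' : a' ⟶ w'} {q' : b' ⟶ w'}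
    {m : a ⟶ a'} {n : b ⟶ b'} (h : m ≫ p' ≫ inv q' = (p ≫ inv q) ≫ n) :
    ∃ g : w ⟶ w', m ≫ p' = p ≫ g ∧ n ≫ q' = q ≫ g := by
  rw [← Category.assoc, IsIso.comp_inv_eq] at h
  refine ⟨inv p ≫ m ≫ p', by simp, ?_⟩
  rw [h]
  simp

instance (F : X ⥤ W) (H : Y ⥤ W) : (fibreProductSplit F H).IsEquivalence where
  faithful := ⟨fun {p q f g} h => fibre_hom_ext
    (congrArg (fun k => CategoricalPullback.Hom.fst k) h)
    (congrArg (fun k => CategoricalPullback.Hom.snd k) h)⟩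
  full := ⟨fun {p q} f => by
    obtain ⟨g, h₁, h₂⟩ := exists_of_split_w (p := p.fiber.1.hom) (q := p.fiber.2.hom)
      (p' := q.fiber.1.hom) (q' := q.fiber.2.hom) f.w
    let φ₁ : CostructuredArrow.mk (p.fiber.1.hom ≫ g) ⟶ q.fiber.1 :=
      CostructuredArrow.homMk f.fst h₁
    let φ₂ : CostructuredArrow.mk (p.fiber.2.hom ≫ g) ⟶ q.fiber.2 :=
      CostructuredArrow.homMk f.snd h₂
    exact ⟨⟨g, (φ₁, φ₂)⟩, rfl⟩⟩
  -- Take `w = H y`, with the given isomorphism on one side and the identity on the other.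
  essSurj := ⟨fun y =>
    ⟨⟨H.obj y.snd, (CostructuredArrow.mk y.iso.hom, CostructuredArrow.mk (𝟙 (H.obj y.snd)))⟩,
      ⟨CategoricalPullback.mkIso (Iso.refl _) (Iso.refl _) (by
        change F.map (𝟙 y.fst) ≫ y.iso.hom = (y.iso.hom ≫ inv (𝟙 (H.obj y.snd))) ≫ H.map (𝟙 y.snd)
        simp)⟩⟩⟩

/-- The skeleton is equivalent to `W`, and base change of a Grothendieck construction along an
equivalence is an equivalence. -/
instance (E : W ⥤ Cat.{u, u}) : (SumOfQuotients.inclusion E).IsEquivalence :=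
  (Grothendieck.preEquivalence E (fromSkeleton W).asEquivalence).isEquivalence_functor

end HomotopySum

/-! ### The left unit law of `S`, up to reindexing. -/

section SymMon

variable {X : Type u} [Groupoid.{u} X]

/-- The index sets of a one-term sequence of sequences and of its term. -/
def finSumUniqueEquiv (n : ℕ) : Fin (∑ _ : Fin 1, n) ≃ Fin n :=
  finSigmaFinEquiv.symm.trans
    { toFun := Sigma.snd
      invFun := fun k => ⟨0, k⟩
      left_inv := fun _ => Sigma.ext (Subsingleton.elim _ _) HEq.rfl
      right_inv := fun _ => rfl }

theorem finSumUniqueEquiv_apply {n : ℕ} (p : Σ _ : Fin 1, Fin n) :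
    finSumUniqueEquiv n (finSigmaFinEquiv p) = p.2 :=
  congrArg (fun p : Σ _ : Fin 1, Fin n => p.2) (Equiv.symm_apply_apply finSigmaFinEquiv p)

/-- The comparison of the concatenation of a one-term sequence of sequences with its term. -/
def flattenUnitHom (x : Fam (𝟭 Bij) X) : Fam.Hom (flattenObj ⟨⟨1⟩, fun _ => x⟩) x where
  base := (finSumUniqueEquiv x.base.card : Fin (∑ _ : Fin 1, x.base.card) ≃ Fin x.base.card)
  fam _ _ h := eqToHom (congrArg x.fam h)

theorem flattenUnitHom_base (x : Fam (𝟭 Bij) X) (k : Fin (∑ _ : Fin 1, x.base.card)) :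
    Bij.equiv (flattenUnitHom x).base k = finSumUniqueEquiv x.base.card k := rfl

theorem finSumUniqueEquiv_eq {n : ℕ} (k : Fin (∑ _ : Fin 1, n)) :
    finSumUniqueEquiv n k = (finSigmaFinEquiv.symm k).2 := rfl

theorem sigmaEquiv_unitMap_snd {x y : Fam (𝟭 Bij) X} (f : Fam.Hom x y)
    (p : Σ _ : Fin 1, Fin x.base.card) :
    (sigmaEquiv (unitMap (X := Fam (𝟭 Bij) X) f) p).2 = Bij.equiv f.base p.2 := rfl

theorem flattenMap_unitMap_base {x y : Fam (𝟭 Bij) X} (f : Fam.Hom x y)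
    (k : Fin (∑ _ : Fin 1, x.base.card)) :
    finSumUniqueEquiv y.base.card
      (Bij.equiv (flattenMap (unitMap (X := Fam (𝟭 Bij) X) f)).base k) =
      Bij.equiv f.base (finSumUniqueEquiv x.base.card k) := by
  refine (congrArg (finSumUniqueEquiv y.base.card)
      (flattenMap_base (unitMap (X := Fam (𝟭 Bij) X) f) k)).trans ?_
  refine (finSumUniqueEquiv_apply (n := y.base.card)
      (sigmaEquiv (unitMap (X := Fam (𝟭 Bij) X) f) (finSigmaFinEquiv.symm k))).trans ?_
  exact (sigmaEquiv_unitMap_snd f (finSigmaFinEquiv.symm k)).trans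
    (congrArg (Bij.equiv f.base) (finSumUniqueEquiv_eq k).symm)

/-- With the target indices written as values of `finSumUniqueEquiv`, the transports in
`flattenUnitHom` are identities. -/
theorem flattenUnitHom_fam_comm {x y : Fam (𝟭 Bij) X} (f : Fam.Hom x y)
    (k : Fin (∑ _ : Fin 1, x.base.card)) (m : Fin (∑ _ : Fin 1, y.base.card))
    (h : Bij.equiv (flattenMap (unitMap (X := Fam (𝟭 Bij) X) f)).base k = m)
    (h' : Bij.equiv f.base (finSumUniqueEquiv x.base.card k) = finSumUniqueEquiv y.base.card m) :
    (flattenMap (unitMap (X := Fam (𝟭 Bij) X) f)).fam k m h ≫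
        (flattenUnitHom y).fam m (finSumUniqueEquiv y.base.card m) rfl =
      (flattenUnitHom x).fam k (finSumUniqueEquiv x.base.card k) rfl ≫
        f.fam (finSumUniqueEquiv x.base.card k) (finSumUniqueEquiv y.base.card m) h' :=
  (Category.comp_id (f.fam (finSumUniqueEquiv x.base.card k) (finSumUniqueEquiv y.base.card m)
    h')).trans (Category.id_comp (f.fam _ _ h')).symm

theorem Fam.Hom.comp_base_apply {x y z : Fam (𝟭 Bij) X} (f : Fam.Hom x y) (g : Fam.Hom y z)
    (i : Fin x.base.card) :
    Bij.equiv (f.comp g).base i = Bij.equiv g.base (Bij.equiv f.base i) := rfl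

theorem flattenUnitHom_naturality {x y : Fam (𝟭 Bij) X} (f : Fam.Hom x y) :
    (flattenMap (unitMap (X := Fam (𝟭 Bij) X) f)).comp (flattenUnitHom y) =
      (flattenUnitHom x).comp f := by
  refine Fam.Hom.ext' ?_ fun k l h h' => ?_
  · refine Bij.hom_ext fun k => ?_
    refine (Fam.Hom.comp_base_apply (flattenMap (unitMap (X := Fam (𝟭 Bij) X) f))
      (flattenUnitHom y) k).trans ?_
    refine (flattenUnitHom_base y _).trans ?_
    refine (flattenMap_unitMap_base f k).trans ?_
    exact (congrArg (Bij.equiv f.base) (flattenUnitHom_base x k)).symm.trans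
      (Fam.Hom.comp_base_apply (flattenUnitHom x) f k).symm
  · have hl := (flattenUnitHom_base y _).symm.trans
      ((Fam.Hom.comp_base_apply (flattenMap (unitMap (X := Fam (𝟭 Bij) X) f))
        (flattenUnitHom y) k).symm.trans h)
    -- This puts the target index in the form in which the transports vanish.
    subst hl
    have hm := (flattenMap_unitMap_base f k).symm
    refine (Fam.Hom.comp_fam (flattenMap (unitMap (X := Fam (𝟭 Bij) X) f)) (flattenUnitHom y)
      rfl (flattenUnitHom_base y _) h).trans ?_
    refine Eq.trans ?_ (Fam.Hom.comp_fam (flattenUnitHom x) f (flattenUnitHom_base x k) hm h').symm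
    exact flattenUnitHom_fam_comm f k _ rfl hm

/-- The left unit law of the symmetric monoidal category monad, up to isomorphism. -/
def flattenUnitIso (X : Type u) [Groupoid.{u} X] :
    unitFunctor (Fam (𝟭 Bij) X) ⋙ flattenFunctor X ≅ 𝟭 _ :=
  NatIso.ofComponents
    (fun x => Groupoid.isoEquivHom _ _ |>.symm (flattenUnitHom x))
    (fun f => flattenUnitHom_naturality f)

/-- Compatibility of the unit isomorphism with change of `X`; it makes the isomorphism of squares
coherent. -/
theorem flattenUnitHom_map {Y : Type u} [Groupoid.{u} Y] (F : X ⥤ Y) (x : Fam (𝟭 Bij) X) :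
    Fam.mapHom F (flattenUnitHom x) = flattenUnitHom ⟨x.base, fun i => F.obj (x.fam i)⟩ :=
  Fam.Hom.ext' rfl fun _ _ h _ => eqToHom_map F (congrArg x.fam h)

end SymMon


/-! ### Cartesianness of `φ`. -/

namespace Poly

variable {I : Type u} (P : Poly I) {X Y : Slice I} (f : X ⟶ Y)

/-- `S` applied to the functor underlying a morphism over `I`. -/
def famMap : Fam (𝟭 Bij) X.left ⥤ Fam (𝟭 Bij) Y.left := S.map f.left

/-- The naturality square of `φ` as a functor to the homotopy pullback. -/
noncomputable def phiComparison : P.Ev X ⥤ CategoricalPullback (famMap f) (P.phiApp Y) :=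
  (CategoricalPullback.CatCommSqOver.toFunctorToCategoricalPullback (famMap f) (P.phiApp Y) _).obj
    ⟨P.phiApp X, P.evMap f, Iso.refl _⟩

/-- The component in `B` is retained by `evMap` and the family of morphisms of `X` by `phiApp`. -/
theorem hom_ext_of_phi {x y : P.Ev X} {g h : x ⟶ y}
    (h₁ : (P.phiApp X).map g = (P.phiApp X).map h) (h₂ : (P.evMap f).map g = (P.evMap f).map h) :
    g = h := by
  have hb : Fam.Hom.base g = Fam.Hom.base h := by
    have := congrArg (fun k => Fam.Hom.base k) h₂
    exact this
  obtain ⟨gb, gf⟩ := g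
  obtain ⟨_, hf⟩ := h
  obtain rfl := hb
  injection h₁ with w₁ w₂
  exact congrArg (Fam.Hom.mk gb) w₂

/-- The component in `B` comes from `h` and the family from `g`; they fit together because `w`
identifies the two bijections. -/
theorem exists_hom_of_phi {x y : P.Ev X} (g : (P.phiApp X).obj x ⟶ (P.phiApp X).obj y)
    (h : (P.evMap f).obj x ⟶ (P.evMap f).obj y)
    (w : (famMap f).map g = (P.phiApp Y).map h) :
    ∃ k : x ⟶ y, (P.phiApp X).map k = g ∧ (P.evMap f).map k = h := by
  obtain ⟨gb, gf⟩ := g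
  obtain ⟨hb, hf⟩ := h
  obtain rfl : gb = P.arity.map hb := congrArg (fun k => Fam.Hom.base k) w
  let k : Fam.Hom x.toFam y.toFam := ⟨hb, gf⟩
  refine ⟨k, rfl, Fam.Hom.ext' rfl fun i j _ h' => ?_⟩
  injection w with w₁ w₂
  exact congrFun (congrFun (congrFun w₂ i) j) h'

/-- Essential surjectivity: keep the operation of `y` and give its input `i` the term of `x` that
the bijection of `e` sends to `i`. -/
theorem exists_obj_of_phi (x : Fam (𝟭 Bij) X.left) (y : P.Ev Y)
    (e : (famMap f).obj x ⟶ (P.phiApp Y).obj y) :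
    ∃ (z : P.Ev X) (g : (P.phiApp X).obj z ⟶ x) (h : (P.evMap f).obj z ⟶ y),
      (famMap f).map g ≫ e = (P.phiApp Y).map h := by
  obtain ⟨eb, ef⟩ := e
  let σ : Fin x.base.card ≃ Fin (P.arity.obj y.toFam.base).card := Bij.equiv eb
  let z : P.Ev X :=
    { toFam := ⟨y.toFam.base, fun i => x.fam (σ.symm i)⟩
      colour := fun i => by
        rw [← y.colour i, ← Over.w f]
        -- The morphism from the image of this term to the `i`-th object of `y` lies over a morphism
        -- of the discrete `I`, hence over an equality of colours.
        exact Discrete.ext (Discrete.eq_of_hom ((Y.hom : Y.left ⥤ Discrete I).map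
          (ef (σ.symm i) i (σ.apply_symm_apply i)))) }
  let g : Fam.Hom ((P.phiApp X).obj z) x :=
    { base := (σ.symm : Fin (P.arity.obj y.toFam.base).card ≃ Fin x.base.card)
      fam := fun i j h => eqToHom (congrArg x.fam h) }
  let h : Fam.Hom ((P.evMap f).obj z).toFam y.toFam :=
    { base := 𝟙 y.toFam.base
      fam := fun i j h => ef (σ.symm i) j ((σ.apply_symm_apply i).trans
        ((congrArg (fun τ => Bij.equiv τ i) (P.arity.map_id y.toFam.base)).symm.trans h)) }
  refine ⟨z, g, h, Fam.Hom.ext' ?_ fun i j h₁ h₂ => ?_⟩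
  · refine Bij.hom_ext fun i => ?_
    refine (σ.apply_symm_apply i).trans ?_
    exact ((congrArg (fun τ => Bij.equiv τ i) (P.arity.map_id y.toFam.base))).symm
  · refine (congrArg (· ≫ ef (σ.symm i) j h₁) (eqToHom_map (f.left : X.left ⥤ Y.left)
      rfl)).trans ?_
    exact Category.id_comp _

instance : (P.phiComparison f).IsEquivalence where
  faithful := ⟨fun {x y g h} e => by
    have h₁ := congrArg (fun k => CategoricalPullback.Hom.fst k) e
    have h₂ := congrArg (fun k => CategoricalPullback.Hom.snd k) e
    exact P.hom_ext_of_phi f h₁ h₂⟩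
  full := ⟨fun {x y} g => by
    obtain ⟨k, h₁, h₂⟩ := P.exists_hom_of_phi f g.fst g.snd
      ((Category.comp_id _).symm.trans (g.w.trans (Category.id_comp _)))
    exact ⟨k, CategoricalPullback.hom_ext h₁ h₂⟩⟩
  essSurj := ⟨fun y => by
    obtain ⟨z, g, h, w⟩ := P.exists_obj_of_phi f y.fst y.snd y.iso.hom
    exact ⟨z, ⟨CategoricalPullback.mkIso (Groupoid.isoEquivHom _ _ |>.symm g)
      (Groupoid.isoEquivHom _ _ |>.symm h)
      (w.trans (Category.id_comp _).symm)⟩⟩⟩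

end Poly

/-! ### The comparison square as a naturality square of `φ`. -/

namespace PolynomialMonad

variable {I : Type u} (R : PolynomialMonad I)

/-- `φ` at `R^n A` as a functor. -/
def phiFunctor (n : ℕ) : R.C (n + 1) ⥤ R.D n := R.phiC n

/-- The composite `C_{n+1} ⟶ D_{n+1} ⟶ D_n` of `η^S` with the top face map. -/
def singleTop (n : ℕ) : R.C (n + 1) ⥤ R.D n := R.G (n + 1) ≫ R.dTop n

/-- The composite of `η^S` with the top face map is isomorphic to `φ`. -/
def singleTopIso (n : ℕ) : R.singleTop n ≅ R.phiFunctor n :=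
  -- Naturality of `η^S` holds strictly, so `singleTop` unfolds to `φ` followed by `η^S` and `μ^S`.
  Functor.isoWhiskerLeft (R.phiFunctor n) (flattenUnitIso (R.C n))

theorem singleTopIso_d₀ (n : ℕ) (c : R.C (n + 2)) :
    (R.d₀ n : R.D (n + 1) ⥤ R.D n).map ((R.singleTopIso (n + 1)).hom.app c) =
      (R.singleTopIso n).hom.app ((R.d₀C (n + 1) : R.C (n + 2) ⥤ R.C (n + 1)).obj c) :=
  flattenUnitHom_map (R.d₀C n : R.C (n + 1) ⥤ R.C n) _

instance : R.comparison.IsEquivalence :=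
  isEquivalence_toCategoricalPullback_of_iso (L' := R.phiFunctor 1) (H' := R.phiFunctor 0)
    (eqToIso R.outer_out)
    (Iso.refl (R.phiFunctor 1 ⋙ R.out)) (R.singleTopIso 1) (R.singleTopIso 0)
    -- Both squares commute strictly, so their 2-cells have identity components and only
    -- `singleTopIso_d₀` remains.
    (fun c => (Category.comp_id _).trans ((R.singleTopIso_d₀ 0 c).trans
      (Category.id_comp _).symm)) (inferInstanceAs (R.P.phiComparison (R.iterFace 0)).IsEquivalence)

end PolynomialMonad

/-! ### From the homotopy pullback to the homotopy sum. -/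

section HomotopySum

variable {W X Y Q : Type u} [Groupoid.{u} W] [Groupoid.{u} X] [Groupoid.{u} Y] [Groupoid.{u} Q]
  {F : X ⥤ W} {H : Y ⥤ W}

/-- A homotopy pullback square exhibits its corner as any category `P` equivalent to the homotopy
sum of the products of the fibres, compatibly with the comparison functor and the projections. -/
theorem exists_equivalence_of_comparison {P : Type u} [Category.{u} P]
    (J : P ⥤ HomotopySum (fibreProduct F H)) [J.IsEquivalence]
    (K : Q ⥤ CategoricalPullback F H) [K.IsEquivalence] :
    ∃ e : Q ≌ P, Nonempty (e.functor ⋙ J ⋙ fibreProductSplit F H ≅ K) ∧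
      Nonempty (e.functor ⋙ J ⋙ fibreProductProj F H ≅
        K ⋙ Functor.prod' (CategoricalPullback.π₁ F H) (CategoricalPullback.π₂ F H)) := by
  let N := J ⋙ fibreProductSplit F H
  let e : Q ≌ P := K.asEquivalence.trans N.asEquivalence.symm
  -- The composite is `K` followed by the inverse of `N` and then `N`. Projecting `i` gives the
  -- second isomorphism, as the splitting commutes strictly with the projections.
  let i : e.functor ⋙ N ≅ K :=
    Functor.isoWhiskerLeft K N.asEquivalence.counitIso ≪≫ K.rightUnitor
  exact ⟨e, ⟨i⟩, ⟨Functor.isoWhiskerRight i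
    (Functor.prod' (CategoricalPullback.π₁ F H) (CategoricalPullback.π₂ F H))⟩⟩

end HomotopySum

theorem PolynomialMonad.outer_inner_green {I : Type u} (R : PolynomialMonad I) :
    Functor.prod' R.outer R.inner ⋙ Functor.prod (𝟭 (R.D 1)) R.green = R.single ⋙ R.edges :=
  (congrArg (fun T : R.C 2 ⥤ R.D 1 => Functor.prod' R.outer T) (R.G_d₀ 1)).symm

end FaaDiBruno

theorem proposition3 {I : Type*} (R : FaaDiBruno.PolynomialMonad I) :
    -- `C₂ ≃ D₁ ×_{D₀} C₁`, and the splitting of this homotopy pullback into its fibres over `D₀`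
    R.comparison.IsEquivalence ∧
    (FaaDiBruno.fibreProductSplit R.out R.inp).IsEquivalence ∧
    -- `C₂ ≃ ∫^w (D₁)_w × _w(C₁)`, compatibly with these, over `D₁ × C₁` and over `D₁ × D₁`
    (∃ e : R.C 2 ≌ FaaDiBruno.HomotopySum (FaaDiBruno.fibreProduct R.out R.inp),
      Nonempty (e.functor ⋙ FaaDiBruno.fibreProductSplit R.out R.inp ≅ R.comparison) ∧
      Nonempty (e.functor ⋙ FaaDiBruno.fibreProductProj R.out R.inp ≅
        Functor.prod' R.outer R.inner) ∧
      Nonempty (e.functor ⋙ FaaDiBruno.fibreProductProj R.out R.inp ⋙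
        Functor.prod (𝟭 (R.D 1)) R.green ≅ R.single ⋙ R.edges)) ∧
    -- the same with the homotopy sum written as `∑_{w ∈ π₀ D₀} ((D₁)_w × _w(C₁)) / Aut(w)`
    (∃ e : R.C 2 ≌ FaaDiBruno.SumOfQuotients (FaaDiBruno.fibreProduct R.out R.inp),
      Nonempty (e.functor ⋙ FaaDiBruno.SumOfQuotients.inclusion _ ⋙
        FaaDiBruno.fibreProductSplit R.out R.inp ≅ R.comparison) ∧
      Nonempty (e.functor ⋙ FaaDiBruno.SumOfQuotients.inclusion _ ⋙
        FaaDiBruno.fibreProductProj R.out R.inp ≅ Functor.prod' R.outer R.inner) ∧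
      Nonempty (e.functor ⋙ FaaDiBruno.SumOfQuotients.inclusion _ ⋙
        FaaDiBruno.fibreProductProj R.out R.inp ⋙
        Functor.prod (𝟭 (R.D 1)) R.green ≅ R.single ⋙ R.edges)) := by
  -- The two forms of the homotopy sum are the cases where `J` is the identity and where it is the
  -- inclusion of the sum of quotients.
  obtain ⟨e, ⟨i⟩, ⟨j⟩⟩ := FaaDiBruno.exists_equivalence_of_comparison (𝟭 _) R.comparison
  obtain ⟨e', ⟨i'⟩, ⟨j'⟩⟩ := FaaDiBruno.exists_equivalence_of_comparison
    (FaaDiBruno.SumOfQuotients.inclusion (FaaDiBruno.fibreProduct R.out R.inp)) R.comparison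
  exact ⟨inferInstance, inferInstance,
    ⟨e, ⟨i⟩, ⟨j⟩, ⟨Functor.isoWhiskerRight j (Functor.prod (𝟭 (R.D 1)) R.green) ≪≫
      eqToIso R.outer_inner_green⟩⟩,
    ⟨e', ⟨i'⟩, ⟨j'⟩, ⟨Functor.isoWhiskerRight j' (Functor.prod (𝟭 (R.D 1)) R.green) ≪≫
      eqToIso R.outer_inner_green⟩⟩⟩
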